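/- Digraphs $G=(V(G),E(G))$ are finite, with $E(G)\subseteq V(G)\times V(G)$ (loops and pairs of opposite edges are allowed). The out-neighborhood complex $\mathcal N(G)$ is the simplicial complex whose vertices are the vertices of $G$ of positive in-degree and whose faces are the nonempty subsets of the out-neighborhoods $\{w : (v,w)\in E(G)\}$, $v\in V(G)$. The product $G\times H$ has vertex set $V(G)\times V(H)$ and an edge from $(g,h)$ to $(g',h')$ exactly when $(g,g')\in E(G)$ and $(h,h')\in E(H)$. In a quotient of a digraph by an equivalence relation on its vertices there is an edge from one class to another exactly when there is an edge from some vertex of the first to some vertex of the second. Let $I^1, I^2, I^3$ be the digraphs on $\{0,1,2\}$ with edge sets $E(I^1)=\{(0,0),(0,1),(1,2)\}$, $E(I^2)=\{(0,0),(1,0),(2,1)\}$, $E(I^3)=\{(1,1),(0,1),(1,2)\}$. For a digraph $G$ let - $M^1(G)=G\times I^1/\{(g,2)\sim(h,2)\ \ \forall g,h\in V(G)\}$, - $M^2(G)=G\times I^2/\{(g,2)\sim(h,2)\ \ \forall g,h\in V(G)\}$, - $M^3(G)=G\times I^3/\{(g,2)\sim(h,2)\text{ and }(g,0)\sim(h,0)\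 \ \forall g,h\in V(G)\}$. **Proposition.** Let $G$ be a digraph such that $\mathcal N(G)$ has $n>0$ vertices. Then there is a homotopy equivalence (of geometric realizations) $$\mathcal N(M^1(G))\simeq \mathcal N(G)\sqcup\{\mathrm{pt}\},$$ and an isomorphism of simplicial complexes $$\mathcal N(M^2(G))\cong \mathcal N(G)\sqcup\Delta^{n-1},$$ where $\Delta^{m}$ is the simplex of dimension $m$; in particular $\mathcal N(M^1(G))\simeq\mathcal N(M^2(G))$. Moreover there is a homotopy equivalence $$\mathcal N(M^3(G))\simeq S(\mathcal N(G)),$$ where $S(X)$ is the (unreduced) suspension of $X$, obtained from $X\times[0,1]$ by collapsing $X\times\{0\}$ to a point and $X\times\{1\}$ to a point. -/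

import Mathlib

open scoped ContinuousMap

namespace DirectedMycielskian

/-! ### Simplicial complexes

A simplicial complex whose vertices lie in a type `α` is a `PreAbstractSimplicialComplex α`:
a family of nonempty finite subsets of `α` closed under passing to nonempty subsets. Elements of `α`
which lie in no face are not vertices of the complex. -/

/-- The vertex set of a simplicial complex. -/
def vertices {α : Type*} (K : PreAbstractSimplicialComplex α) : Set α :=
  {v | ({v} : Finset α) ∈ K.faces}

/-- The geometric realization of a simplicial complex `K` on a finite type `α`: the space of all
systems of barycentric coordinates carried by a face of `K`, as a subspace of `ℝ^α`. -/
def realization {α : Type*} [Finite α] (K : PreAbstractSimplicialComplex α) : Set (α → ℝ) :=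
  {x | (∀ v, 0 ≤ x v) ∧ ∃ s ∈ K.faces, (∀ v, v ∉ s → x v = 0) ∧ ∑ v ∈ s, x v = 1}

/-- An isomorphism of simplicial complexes: a bijection of the vertex sets under which
a finite set of vertices is a face if and only if its image is a face. -/
structure SimplicialIso {α β : Type*} (K : PreAbstractSimplicialComplex α)
    (L : PreAbstractSimplicialComplex β) where
  /-- the bijection between the vertex sets -/
  toEquiv : vertices K ≃ vertices L
  mem_faces_iff : ∀ s : Finset (vertices K),
    s.map (Function.Embedding.subtype _) ∈ K.faces ↔
      (s.map toEquiv.toEmbedding).map (Function.Embedding.subtype _) ∈ L.faces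

/-- The disjoint union of two simplicial complexes. -/
def disjointUnion {α β : Type*} (K : PreAbstractSimplicialComplex α)
    (L : PreAbstractSimplicialComplex β) : PreAbstractSimplicialComplex (α ⊕ β) where
  faces := {s | (∃ t ∈ K.faces, s = t.map Function.Embedding.inl) ∨
    ∃ t ∈ L.faces, s = t.map Function.Embedding.inr}
  isRelLowerSet_faces := by
    rintro s (⟨t, ht, rfl⟩ | ⟨t, ht, rfl⟩)
    · refine ⟨(K.isRelLowerSet_faces ht).1.map, fun u hu hne => Or.inl ?_⟩
      obtain ⟨u', hu', rfl⟩ := Finset.subset_map_iff.mp hu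
      exact ⟨u', (K.isRelLowerSet_faces ht).2 hu' (Finset.map_nonempty.mp hne), rfl⟩
    · refine ⟨(L.isRelLowerSet_faces ht).1.map, fun u hu hne => Or.inr ?_⟩
      obtain ⟨u', hu', rfl⟩ := Finset.subset_map_iff.mp hu
      exact ⟨u', (L.isRelLowerSet_faces ht).2 hu' (Finset.map_nonempty.mp hne), rfl⟩

/-- The `m`-dimensional simplex: all nonempty subsets of a set with `m + 1` elements. -/
def simplex (m : ℕ) : PreAbstractSimplicialComplex (Fin (m + 1)) := ⊤

/-! ### Suspension -/

/-- The equivalence relation on `X × [0,1]` which identifies `X × {0}` to a point and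
`X × {1}` to a point. -/
def suspensionSetoid (X : Type*) : Setoid (X × unitInterval) where
  r p q := p = q ∨ (p.2 = 0 ∧ q.2 = 0) ∨ (p.2 = 1 ∧ q.2 = 1)
  iseqv :=
    { refl := fun _ => Or.inl rfl
      symm := by
        rintro p q (h | h | h)
        · exact Or.inl h.symm
        · exact Or.inr (Or.inl h.symm)
        · exact Or.inr (Or.inr h.symm)
      trans := by
        rintro p q r (rfl | h | h) (rfl | h' | h')
        · exact Or.inl rfl
        · exact Or.inr (Or.inl h')
        · exact Or.inr (Or.inr h')
        · exact Or.inr (Or.inl h)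
        · exact Or.inr (Or.inl ⟨h.1, h'.2⟩)
        · exact absurd (h.2.symm.trans h'.1) zero_ne_one
        · exact Or.inr (Or.inr h)
        · exact absurd (h'.1.symm.trans h.2) zero_ne_one
        · exact Or.inr (Or.inr ⟨h.1, h'.2⟩) }

/-- The (unreduced) suspension of a nonempty space `X`, with the quotient topology. -/
abbrev Suspension (X : Type*) [TopologicalSpace X] : Type _ :=
  Quotient (suspensionSetoid X)

/-! ### Directed graphs -/

/-- The out-neighborhood complex of a digraph: its faces are the nonempty finite sets of vertices
contained in the out-neighborhood of some vertex. -/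
def outNbhdComplex {V : Type*} (G : Digraph V) : PreAbstractSimplicialComplex V where
  faces := {s | s.Nonempty ∧ ∃ v, ∀ w ∈ s, G.Adj v w}
  isRelLowerSet_faces := by
    rintro s ⟨hs, v, hv⟩
    exact ⟨hs, fun t ht hne => ⟨hne, v, fun w hw => hv w (ht hw)⟩⟩

/-- The vertices of the out-neighborhood complex are the vertices of positive in-degree. -/
theorem mem_vertices_outNbhdComplex {V : Type*} (G : Digraph V) (w : V) :
    w ∈ vertices (outNbhdComplex G) ↔ ∃ v, G.Adj v w := by
  simp [vertices, outNbhdComplex]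

/-- The categorical product of two digraphs. -/
def product {V W : Type*} (G : Digraph V) (H : Digraph W) : Digraph (V × W) where
  Adj p q := G.Adj p.1 q.1 ∧ H.Adj p.2 q.2

/-- The quotient of a digraph by an equivalence relation on its vertices: there is an edge between
two classes if there is an edge between some representatives. -/
def quotient {V : Type*} (G : Digraph V) (r : Setoid V) : Digraph (Quotient r) where
  Adj a b := ∃ x y, G.Adj x y ∧ Quotient.mk r x = a ∧ Quotient.mk r y = b

/-- The equivalence relation on `V × {0,1,2}` that identifies all `(g, i)` and `(h, i)` with
`g h : V` for each level `i ∈ S`. -/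
def collapse (V : Type*) (S : Set (Fin 3)) : Setoid (V × Fin 3) where
  r p q := p = q ∨ (p.2 = q.2 ∧ p.2 ∈ S)
  iseqv :=
    { refl := fun _ => Or.inl rfl
      symm := by
        rintro p q (h | ⟨h, hS⟩)
        · exact Or.inl h.symm
        · exact Or.inr ⟨h.symm, h ▸ hS⟩
      trans := by
        rintro p q r (rfl | ⟨h, hS⟩) (rfl | ⟨h', hS'⟩)
        · exact Or.inl rfl
        · exact Or.inr ⟨h', hS'⟩
        · exact Or.inr ⟨h, hS⟩
        · exact Or.inr ⟨h.trans h', hS⟩ }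

/-- The digraph with edges `0 → 0`, `0 → 1`, `1 → 2`. -/
def I₁ : Digraph (Fin 3) where
  Adj i j := (i = 0 ∧ j = 0) ∨ (i = 0 ∧ j = 1) ∨ (i = 1 ∧ j = 2)

/-- The digraph with edges `0 → 0`, `1 → 0`, `2 → 1`. -/
def I₂ : Digraph (Fin 3) where
  Adj i j := (i = 0 ∧ j = 0) ∨ (i = 1 ∧ j = 0) ∨ (i = 2 ∧ j = 1)

/-- The digraph with edges `1 → 1`, `0 → 1`, `1 → 2`. -/
def I₃ : Digraph (Fin 3) where
  Adj i j := (i = 1 ∧ j = 1) ∨ (i = 0 ∧ j = 1) ∨ (i = 1 ∧ j = 2)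

/-- The first directed Mycielskian. -/
def M₁ {V : Type*} (G : Digraph V) : Digraph (Quotient (collapse V {2})) :=
  quotient (product G I₁) (collapse V {2})

/-- The second directed Mycielskian. -/
def M₂ {V : Type*} (G : Digraph V) : Digraph (Quotient (collapse V {2})) :=
  quotient (product G I₂) (collapse V {2})

/-- The third directed Mycielskian. -/
def M₃ {V : Type*} (G : Digraph V) : Digraph (Quotient (collapse V {0, 2})) :=
  quotient (product G I₃) (collapse V {0, 2})

end DirectedMycielskian

/-!
All four claims follow from reading off the out-neighborhoods of the three digraphs
(`mem_faces_M₁_iff`, `mem_faces_M₂_iff`, `mem_faces_M₃_iff`). Write `N` for the out-neighborhood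
complex of `G`.

* For `M₁ G` they are the sets `F × {0, 1}` with `F` an out-neighborhood of `G`, together with the
  isolated vertex of level `2`. Projecting `F × {0, 1}` to `F` is inverse to the inclusion of level
  `0` up to contiguity, and contiguous simplicial maps are homotopic along straight lines
  (`nonempty_homotopyEquiv_of_contiguous`), so the complex is `N ⊔ pt` up to homotopy.
* For `M₂ G` they are the out-neighborhoods of `G` at level `0` and the set of all vertices of `N`
  at level `1`, so the complex is `N ⊔ Δⁿ⁻¹` on the nose. Contiguity again compares it with `M₁ G`.
* For `M₃ G` they are the set of all vertices of `N` at level `1`, and the sets `F ∪ {apex}` for `F`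
  a nonempty out-neighborhood of `G`. The complex is thus the cone on `N` with its base filled by a
  simplex (`coneFill`). Collapsing the simplex, which is contractible, turns the cone into the
  suspension. This is made explicit in `nonempty_homotopyEquiv_suspension`: the realization is a
  quotient of `|N| × [0,1] ⊔ Δ` by compactness, so maps and homotopies out of it may be defined on
  the cone and on the simplex separately; the homotopy inverse sends the segment of the suspension
  over `x` to the path that runs from the centre of the simplex to `x` and on to the apex.
-/

namespace DirectedMycielskian

open Topology

/-! ### Filling the base of a cone -/

section ConeFilling

variable {X D L : Type*} [TopologicalSpace X] [TopologicalSpace D] [TopologicalSpace L]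

/-- A homotopy between maps on the target `L` of a quotient map `q` may be prescribed on the source
of `q`, if it is constant on the fibres of `q`: as a map into the space of paths it descends to `L`,
and it can be uncurried again because the unit interval is locally compact. -/
theorem homotopic_of_isQuotientMap {Y Z : Type*} [TopologicalSpace Y] [TopologicalSpace Z]
    {q : C(Y, L)} (hq : IsQuotientMap q) (f g : C(L, Z)) (H : C(Y × unitInterval, Z))
    (hH : ∀ a b, q a = q b → ∀ u, H (a, u) = H (b, u))
    (h0 : ∀ a, H (a, 0) = f (q a)) (h1 : ∀ a, H (a, 1) = g (q a)) : f.Homotopic g := by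
  have key : Function.FactorsThrough H.curry q := fun a b hab =>
    ContinuousMap.ext fun u => hH a b hab u
  have hlift : ∀ a, hq.lift H.curry key (q a) = H.curry a := fun a =>
    DFunLike.congr_fun (hq.lift_comp H.curry key) a
  refine ⟨⟨⟨fun p => hq.lift H.curry key p.2 p.1, by fun_prop⟩, fun l => ?_, fun l => ?_⟩⟩
  · obtain ⟨a, rfl⟩ := hq.surjective l
    simp [hlift, h0]
  · obtain ⟨a, rfl⟩ := hq.surjective l
    simp [hlift, h1]

/-- The path through the space obtained from the cone on `X` by attaching `D` to its base, at
parameter `s`: for `s ≤ 1 / 2` it runs inside `D` from the centre of the contraction `h` to `j x`,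
and for `s ≥ 1 / 2` up the cone, from `j x` to the apex. -/
noncomputable def conePath (c : C(X × unitInterval, L)) (i : C(D, L)) (j : C(X, D)) {b : D}
    (h : (ContinuousMap.id D).Homotopy (ContinuousMap.const D b))
    (hc0 : ∀ x, c (x, 0) = i (j x)) : C(X × ℝ, L) where
  toFun p := if p.2 ≤ 1 / 2 then i (h (Set.projIcc 0 1 zero_le_one (1 - 2 * p.2), j p.1))
    else c (p.1, Set.projIcc 0 1 zero_le_one (2 * p.2 - 1))
  continuous_toFun := by
    refine Continuous.if_le ?_ ?_ continuous_snd continuous_const ?_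
    · exact i.continuous.comp (h.continuous.comp
        (((continuous_projIcc).comp (by fun_prop)).prodMk (by fun_prop)))
    · exact c.continuous.comp (continuous_fst.prodMk ((continuous_projIcc).comp (by fun_prop)))
    · rintro ⟨x, s⟩ hs
      have hs' : s = 1 / 2 := hs
      subst hs'
      norm_num
      exact (hc0 x).symm

/-- If a quotient map presents `L` as the cone on a nonempty space `X` whose base is glued along
`j` to a contractible space `D`, then `L` is homotopy equivalent to the suspension of `X`. One map
collapses `D` to the pole at `0`, the other sends the segment over `x` to the path `conePath`. -/
theorem nonempty_homotopyEquiv_suspension [Nonempty X]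
    (c : C(X × unitInterval, L)) (i : C(D, L)) (j : C(X, D)) {b : D}
    (h : (ContinuousMap.id D).Homotopy (ContinuousMap.const D b))
    (hq : IsQuotientMap (Sum.elim c i))
    (hc0 : ∀ x, c (x, 0) = i (j x)) (hc1 : ∀ x y, c (x, 1) = c (y, 1))
    (hcc : ∀ p q, c p = c q → p = q ∨ (p.2 = 0 ∧ q.2 = 0) ∨ (p.2 = 1 ∧ q.2 = 1))
    (hci : ∀ x t d, c (x, t) = i d → t = 0 ∧ d = j x) (hi : Function.Injective i) :
    Nonempty (L ≃ₕ Suspension X) := by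
  let x₀ : X := Classical.arbitrary X
  let Q : C((X × unitInterval) ⊕ D, L) := ⟨Sum.elim c i, hq.continuous⟩
  have hQ : IsQuotientMap Q := hq
  let P : C(X × unitInterval, Suspension X) := ⟨Quotient.mk _, continuous_quotient_mk'⟩
  have hP : IsQuotientMap P := isQuotientMap_quotient_mk'
  have hP0 : ∀ x y, P (x, 0) = P (y, 0) := fun x y => Quotient.sound (Or.inr (Or.inl ⟨rfl, rfl⟩))
  have hP1 : ∀ x y, P (x, 1) = P (y, 1) := fun x y => Quotient.sound (Or.inr (Or.inr ⟨rfl, rfl⟩))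
  have hPP : ∀ p q, P p = P q → p = q ∨ (p.2 = 0 ∧ q.2 = 0) ∨ (p.2 = 1 ∧ q.2 = 1) :=
    fun p q hpq => Quotient.exact hpq
  -- An equivalence relation contains the kernel of `Q` once it glues the base and the apex.
  have fib : ∀ r : Setoid ((X × unitInterval) ⊕ D),
      (∀ x, r (.inl (x, 0)) (.inr (j x))) → (∀ x y, r (.inl (x, 1)) (.inl (y, 1))) →
      ∀ a a', Q a = Q a' → r a a' := by
    intro r h0 h1 a a' haa'
    have hbase : ∀ x y, c (x, 0) = c (y, 0) → r (.inl (x, 0)) (.inl (y, 0)) := by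
      intro x y hxy
      rw [hc0, hc0] at hxy
      exact r.trans (h0 x) (hi hxy ▸ r.symm (h0 y))
    rcases a with ⟨x, t⟩ | d <;> rcases a' with ⟨y, s⟩ | d'
    · have haa : c (x, t) = c (y, s) := haa'
      rcases hcc _ _ haa with he | ⟨ht, hs⟩ | ⟨ht, hs⟩
      · rw [he]
      · obtain rfl : t = 0 := ht
        obtain rfl : s = 0 := hs
        exact hbase x y haa
      · obtain rfl : t = 1 := ht
        obtain rfl : s = 1 := hs
        exact h1 x y
    · obtain ⟨rfl, rfl⟩ := hci x t d' haa'
      exact h0 x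
    · obtain ⟨rfl, rfl⟩ := hci y s d haa'.symm
      exact r.symm (h0 y)
    · rw [hi (show i d = i d' from haa')]
  have fibP : ∀ r : Setoid (X × unitInterval),
      (∀ x y, r (x, 0) (y, 0)) → (∀ x y, r (x, 1) (y, 1)) → ∀ a a', P a = P a' → r a a' := by
    rintro r h0 h1 ⟨x, t⟩ ⟨y, s⟩ haa'
    rcases hPP _ _ haa' with he | ⟨ht, hs⟩ | ⟨ht, hs⟩
    · rw [he]
    · obtain rfl : t = 0 := ht
      obtain rfl : s = 0 := hs
      exact h0 x y
    · obtain rfl : t = 1 := ht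
      obtain rfl : s = 1 := hs
      exact h1 x y
  let γ := conePath c i j h hc0
  have γlow : ∀ x (s : ℝ), s ≤ 1 / 2 →
      γ (x, s) = i (h (Set.projIcc 0 1 zero_le_one (1 - 2 * s), j x)) := fun x s hs => if_pos hs
  have γhigh : ∀ x (s : ℝ), 1 / 2 ≤ s →
      γ (x, s) = c (x, Set.projIcc 0 1 zero_le_one (2 * s - 1)) := by
    intro x s hs
    rcases hs.eq_or_lt with rfl | hs
    · rw [γlow _ _ le_rfl]
      norm_num
      exact (hc0 x).symm
    · exact if_neg (not_le.mpr hs)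
  have γ0 : ∀ x, γ (x, 0) = i b := by
    intro x
    rw [γlow _ _ (by norm_num)]
    simp
  have γ1 : ∀ x, γ (x, 1) = c (x, 1) := by
    intro x
    rw [γhigh _ _ (by norm_num)]
    norm_num
  -- The two maps.
  let f' : C((X × unitInterval) ⊕ D, Suspension X) :=
    ⟨Sum.elim P fun _ => P (x₀, 0), P.continuous.sumElim continuous_const⟩
  have hf' : Function.FactorsThrough f' Q :=
    fun a a' => fib (Setoid.ker f') (fun x => hP0 x x₀) (fun x y => hP1 x y) a a'
  let f : C(L, Suspension X) := hQ.lift f' hf'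
  have hf : ∀ a, f (Q a) = f' a := fun a => DFunLike.congr_fun (hQ.lift_comp f' hf') a
  have hfc : ∀ p, f (c p) = P p := fun p => hf (.inl p)
  have hfi : ∀ d x, f (i d) = P (x, 0) := fun d x => (hf (.inr d)).trans (hP0 _ _)
  let g' : C(X × unitInterval, L) := ⟨fun p => γ (p.1, (p.2 : ℝ)), by fun_prop⟩
  have hg' : Function.FactorsThrough g' P :=
    fun a a' => fibP (Setoid.ker g') (fun x y => by simp [Setoid.ker_def, g', γ0])
      (fun x y => by simpa [Setoid.ker_def, g', γ1] using hc1 x y) a a'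
  let g : C(Suspension X, L) := hP.lift g' hg'
  have hg : ∀ x t, g (P (x, t)) = γ (x, (t : ℝ)) :=
    fun x t => DFunLike.congr_fun (hP.lift_comp g' hg') (x, t)
  refine ⟨⟨f, g, ?_, ?_⟩⟩
  · -- From the identity to `g ∘ f`: contract `D`, and stretch the cone downwards into `D`.
    refine ContinuousMap.Homotopic.symm ?_
    let Hs : C(((X × unitInterval) × unitInterval) ⊕ (D × unitInterval), L) :=
      ⟨Sum.elim (fun p => γ (p.1.1, (1 + (p.1.2 : ℝ)) / 2 - (p.2 : ℝ) * (1 - (p.1.2 : ℝ)) / 2))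
        (fun p => i (h (p.2, p.1))), Continuous.sumElim (by fun_prop) (by fun_prop)⟩
    let H : C(((X × unitInterval) ⊕ D) × unitInterval, L) :=
      Hs.comp ⟨_, (Homeomorph.sumProdDistrib).continuous⟩
    have Hl : ∀ x t u, H (.inl (x, t), u) =
        γ (x, (1 + (t : ℝ)) / 2 - (u : ℝ) * (1 - (t : ℝ)) / 2) := fun x t u => rfl
    have Hr : ∀ d u, H (.inr d, u) = i (h (u, d)) := fun d u => rfl
    refine homotopic_of_isQuotientMap hQ _ _ H ?_ ?_ ?_
    · intro a a' haa' u
      refine fib (Setoid.ker fun a => H (a, u)) ?_ ?_ a a' haa'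
      · intro x
        simp only [Setoid.ker_def, Hl, Hr]
        rw [γlow _ _ (by have := u.2.1; simp; linarith)]
        congr 3
        have : 1 - 2 * ((1 + ((0 : unitInterval) : ℝ)) / 2
            - (u : ℝ) * (1 - ((0 : unitInterval) : ℝ)) / 2) = u := by
          simp; ring
        rw [this, Set.projIcc_val]
      · intro x y
        simp only [Setoid.ker_def, Hl]
        norm_num [γ1]
        exact hc1 x y
    · rintro (⟨x, t⟩ | d)
      · rw [Hl, γhigh _ _ (by have := t.2.1; simp; linarith)]
        have : 2 * ((1 + (t : ℝ)) / 2 - ((0 : unitInterval) : ℝ) * (1 - (t : ℝ)) / 2) - 1 = t := by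
          simp; ring
        rw [this, Set.projIcc_val]
        rfl
      · rw [Hr]
        simp [Q]
    · rintro (⟨x, t⟩ | d)
      · have : (1 + (t : ℝ)) / 2 - ((1 : unitInterval) : ℝ) * (1 - (t : ℝ)) / 2 = t := by
          simp; ring
        rw [Hl, this]
        exact ((congrArg g (hfc (x, t))).trans (hg x t)).symm
      · rw [Hr]
        refine Eq.symm ((congrArg g (hfi d x₀)).trans ((hg x₀ 0).trans ?_))
        simp [γ0]
  · -- `f ∘ g` squeezes the lower half of the suspension to the pole: a reparametrization.
    let H : C((X × unitInterval) × unitInterval, Suspension X) :=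
      ⟨fun p => P (p.1.1, Set.projIcc 0 1 zero_le_one
        ((1 - (p.2 : ℝ)) * (2 * (p.1.2 : ℝ) - 1) + (p.2 : ℝ) * (p.1.2 : ℝ))),
        P.continuous.comp (by
          refine Continuous.prodMk (by fun_prop) ((continuous_projIcc).comp (by fun_prop)))⟩
    have Ha : ∀ x t u, H ((x, t), u) = P (x, Set.projIcc 0 1 zero_le_one
        ((1 - (u : ℝ)) * (2 * (t : ℝ) - 1) + (u : ℝ) * (t : ℝ))) := fun x t u => rfl
    refine homotopic_of_isQuotientMap hP _ _ H ?_ ?_ ?_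
    · intro a a' haa' u
      refine fibP (Setoid.ker fun a => H (a, u)) ?_ ?_ a a' haa'
      · intro x y
        simp only [Setoid.ker_def, Ha]
        rw [Set.projIcc_of_le_left _ (by have := u.2.2; simp; linarith)]
        exact hP0 x y
      · intro x y
        simp only [Setoid.ker_def, Ha]
        rw [Set.projIcc_of_right_le _ (by simp; linarith)]
        exact hP1 x y
    · rintro ⟨x, t⟩
      have e : (1 - ((0 : unitInterval) : ℝ)) * (2 * (t : ℝ) - 1)
          + ((0 : unitInterval) : ℝ) * (t : ℝ) = 2 * t - 1 := by simp
      rw [Ha, e]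
      refine Eq.symm ((congrArg f (hg x t)).trans ?_)
      rcases le_total (t : ℝ) (1 / 2) with ht | ht
      · rw [γlow _ _ ht, hfi _ x, Set.projIcc_of_le_left _ (by linarith)]
        rfl
      · rw [γhigh _ _ ht, hfc]
    · rintro ⟨x, t⟩
      have e : (1 - ((1 : unitInterval) : ℝ)) * (2 * (t : ℝ) - 1)
          + ((1 : unitInterval) : ℝ) * (t : ℝ) = t := by simp
      rw [Ha, e, Set.projIcc_val]
      rfl

end ConeFilling

/-! ### Geometric realizations -/

section Realization

variable {α β : Type*}

theorem mem_realization_iff [Fintype α] {K : PreAbstractSimplicialComplex α} {x : α → ℝ} :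
    x ∈ realization K ↔ x ∈ stdSimplex ℝ α ∧ ∃ s ∈ K.faces, ∀ v, v ∉ s → x v = 0 := by
  have key : ∀ s : Finset α, (∀ v, v ∉ s → x v = 0) → ∑ v ∈ s, x v = ∑ v, x v := fun s hs =>
    Finset.sum_subset (Finset.subset_univ s) fun v _ hv => hs v hv
  constructor
  · rintro ⟨h0, s, hs, hx, h1⟩
    exact ⟨⟨h0, key s hx ▸ h1⟩, s, hs, hx⟩
  · rintro ⟨⟨h0, h1⟩, s, hs, hx⟩
    exact ⟨h0, s, hs, hx, (key s hx).trans h1⟩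

theorem isCompact_realization [Finite α] (K : PreAbstractSimplicialComplex α) :
    IsCompact (realization K) := by
  have := Fintype.ofFinite α
  have e : realization K = ⋃ s ∈ K.faces, stdSimplex ℝ α ∩ {x | ∀ v, v ∉ s → x v = 0} := by
    ext x
    simp only [mem_realization_iff, Set.mem_iUnion, Set.mem_inter_iff, Set.mem_ofPred_eq,
      exists_prop]
    tauto
  rw [e]
  refine (Set.toFinite K.faces).isCompact_biUnion fun s _ =>
    (isCompact_stdSimplex ℝ α).inter_right ?_
  simp only [Set.ofPred_forall]
  exact isClosed_iInter fun v => isClosed_iInter fun _ =>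
    isClosed_eq (continuous_apply v) continuous_const

instance [Finite α] (K : PreAbstractSimplicialComplex α) : CompactSpace (realization K) :=
  isCompact_iff_compactSpace.mp (isCompact_realization K)

/-- Points carried by a common face are joined by a segment in the realization. -/
theorem combo_mem_realization [Finite α] {K : PreAbstractSimplicialComplex α} {x y : α → ℝ}
    (hx : x ∈ realization K) (hy : y ∈ realization K) {s : Finset α} (hs : s ∈ K.faces)
    (hxs : ∀ v, v ∉ s → x v = 0) (hys : ∀ v, v ∉ s → y v = 0) {t : ℝ} (h0 : 0 ≤ t) (h1 : t ≤ 1) :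
    (1 - t) • x + t • y ∈ realization K := by
  have := Fintype.ofFinite α
  rw [mem_realization_iff] at *
  exact ⟨convex_stdSimplex ℝ α hx.1 hy.1 (by linarith) h0 (by ring), s, hs,
    fun v hv => by simp [hxs v hv, hys v hv]⟩

variable [Finite α] [Finite β]

/-- A map of vertices which maps faces to faces maps realizations to realizations. -/
theorem linearMap_mem_realization [DecidableEq β] {K : PreAbstractSimplicialComplex α}
    {L : PreAbstractSimplicialComplex β} {φ : α → β} {s : Finset α}
    (hφ : s.image φ ∈ L.faces) {x : α → ℝ} (hx : x ∈ realization K)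
    (hs : ∀ v, v ∉ s → x v = 0) :
    FunOnFinite.linearMap ℝ ℝ φ x ∈ realization L ∧
      ∀ w, w ∉ s.image φ → FunOnFinite.linearMap ℝ ℝ φ x w = 0 := by
  have := Fintype.ofFinite α
  have := Fintype.ofFinite β
  have h : ∀ w, w ∉ s.image φ → FunOnFinite.linearMap ℝ ℝ φ x w = 0 := by
    intro w hw
    rw [FunOnFinite.linearMap_apply_apply]
    refine Finset.sum_eq_zero fun v hv => hs v fun hvs => hw ?_
    rw [← (Finset.mem_filter.mp hv).2]
    exact Finset.mem_image_of_mem φ hvs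
  exact ⟨mem_realization_iff.mpr ⟨stdSimplex.image_linearMap φ
    ⟨x, (mem_realization_iff.mp hx).1, rfl⟩, _, hφ, h⟩, h⟩

/-- The continuous map of realizations induced by a simplicial map. -/
noncomputable def realizationMap [DecidableEq β] {K : PreAbstractSimplicialComplex α}
    {L : PreAbstractSimplicialComplex β} (φ : α → β)
    (hφ : ∀ s ∈ K.faces, s.image φ ∈ L.faces) : C(realization K, realization L) where
  toFun x := ⟨FunOnFinite.linearMap ℝ ℝ φ x, x.2.2.elim fun s h =>
    (linearMap_mem_realization (hφ s h.1) x.2 h.2.1).1⟩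
  continuous_toFun := Continuous.subtype_mk
    ((FunOnFinite.continuous_linearMap ℝ ℝ φ).comp continuous_subtype_val) _

/-- A simplicial self-map contiguous to the identity induces a map homotopic to the identity,
along straight lines. -/
theorem homotopic_id_of_contiguous [DecidableEq α] {K : PreAbstractSimplicialComplex α}
    (φ : α → α)
    (hφ : ∀ s ∈ K.faces, s ∪ s.image φ ∈ K.faces) (f : C(realization K, realization K))
    (hf : ∀ x, (f x : α → ℝ) = FunOnFinite.linearMap ℝ ℝ φ x) :
    f.Homotopic (ContinuousMap.id _) := by
  have hmem : ∀ p : unitInterval × realization K,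
      (1 - (p.1 : ℝ)) • (f p.2 : α → ℝ) + (p.1 : ℝ) • (p.2 : α → ℝ) ∈ realization K := by
    intro p
    obtain ⟨_, s, hs, hxs, _⟩ := p.2.2
    have hne := (K.isRelLowerSet_faces hs).1
    have himg : s.image φ ∈ K.faces :=
      (K.isRelLowerSet_faces (hφ s hs)).2 Finset.subset_union_right (hne.image φ)
    refine combo_mem_realization (f p.2).2 p.2.2 (hφ s hs) (fun v hv => ?_) (fun v hv => ?_)
      p.1.2.1 p.1.2.2
    · rw [hf]
      exact (linearMap_mem_realization himg p.2.2 hxs).2 v fun h =>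
        hv (Finset.mem_union_right _ h)
    · exact hxs v fun h => hv (Finset.mem_union_left _ h)
  refine ⟨⟨⟨fun p => ⟨_, hmem p⟩, Continuous.subtype_mk (by fun_prop) _⟩,
    fun x => ?_, fun x => ?_⟩⟩
  · ext v
    simp
  · ext v
    simp

/-- Simplicial maps in both directions whose composites are contiguous to the identities induce a
homotopy equivalence of realizations. -/
theorem nonempty_homotopyEquiv_of_contiguous [DecidableEq α] [DecidableEq β]
    {K : PreAbstractSimplicialComplex α}
    {L : PreAbstractSimplicialComplex β} (φ : α → β) (ψ : β → α)
    (hφ : ∀ s ∈ K.faces, s.image φ ∈ L.faces) (hψ : ∀ s ∈ L.faces, s.image ψ ∈ K.faces)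
    (hψφ : ∀ s ∈ K.faces, s ∪ s.image (ψ ∘ φ) ∈ K.faces)
    (hφψ : ∀ s ∈ L.faces, s ∪ s.image (φ ∘ ψ) ∈ L.faces) :
    Nonempty (realization K ≃ₕ realization L) := by
  refine ⟨⟨realizationMap φ hφ, realizationMap ψ hψ, homotopic_id_of_contiguous _ hψφ _ fun x => ?_,
    homotopic_id_of_contiguous _ hφψ _ fun x => ?_⟩⟩
  · rw [FunOnFinite.linearMap_comp]
    rfl
  · rw [FunOnFinite.linearMap_comp]
    rfl

/-- The realization of a disjoint union is the disjoint union of the realizations. -/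
theorem nonempty_realization_disjointUnion_homeomorph (K : PreAbstractSimplicialComplex α)
    (L : PreAbstractSimplicialComplex β) :
    Nonempty (realization (disjointUnion K L) ≃ₜ realization K ⊕ realization L) := by
  have := Fintype.ofFinite α
  have := Fintype.ofFinite β
  let f : realization K ⊕ realization L → realization (disjointUnion K L) :=
    Sum.elim
      (fun x => ⟨Sum.elim x 0, by
        obtain ⟨h, s, hs, hxs⟩ := mem_realization_iff.mp x.2
        refine mem_realization_iff.mpr ⟨⟨?_, ?_⟩, _, Or.inl ⟨s, hs, rfl⟩, ?_⟩
        · rintro (a | b)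
          · exact h.1 a
          · exact le_rfl
        · simpa using h.2
        · rintro (a | b) hv
          · exact hxs a (by simpa using hv)
          · rfl⟩)
      (fun x => ⟨Sum.elim 0 x, by
        obtain ⟨h, s, hs, hxs⟩ := mem_realization_iff.mp x.2
        refine mem_realization_iff.mpr ⟨⟨?_, ?_⟩, _, Or.inr ⟨s, hs, rfl⟩, ?_⟩
        · rintro (a | b)
          · exact le_rfl
          · exact h.1 b
        · simpa using h.2
        · rintro (a | b) hv
          · rfl
          · exact hxs b (by simpa using hv)⟩)
  have hf : Continuous f := by
    refine Continuous.sumElim (Continuous.subtype_mk (continuous_pi ?_) _)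
      (Continuous.subtype_mk (continuous_pi ?_) _) <;> rintro (a | b)
    · exact (continuous_apply a).comp continuous_subtype_val
    · exact continuous_const
    · exact continuous_const
    · exact (continuous_apply b).comp continuous_subtype_val
  have hne : ∀ (x : realization K) (y : realization L), f (.inl x) ≠ f (.inr y) := by
    intro x y hxy
    have h0 : ∀ a, (x : α → ℝ) a = 0 := fun a => congrFun (congrArg Subtype.val hxy) (.inl a)
    have := (mem_realization_iff.mp x.2).1.2
    simp [h0] at this
  have hinj : Function.Injective f := by
    rintro (x | x) (y | y) hxy
    · exact congrArg Sum.inl (Subtype.ext (funext fun a =>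
        congrFun (congrArg Subtype.val hxy) (.inl a)))
    · exact absurd hxy (hne x y)
    · exact absurd hxy.symm (hne y x)
    · exact congrArg Sum.inr (Subtype.ext (funext fun b =>
        congrFun (congrArg Subtype.val hxy) (.inr b)))
  have hsurj : Function.Surjective f := by
    intro z
    obtain ⟨h, s, hs, hzs⟩ := mem_realization_iff.mp z.2
    rcases hs with ⟨t, ht, rfl⟩ | ⟨t, ht, rfl⟩
    · have h0 : ∀ b, (z : α ⊕ β → ℝ) (.inr b) = 0 := fun b => hzs _ (by simp)
      refine ⟨.inl ⟨fun a => (z : α ⊕ β → ℝ) (.inl a), mem_realization_iff.mpr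
        ⟨⟨fun a => h.1 _, ?_⟩, t, ht, fun a ha => hzs _ (by simpa using ha)⟩⟩, ?_⟩
      · simpa [h0] using h.2
      · refine Subtype.ext (funext ?_)
        rintro (a | b)
        · rfl
        · exact (h0 b).symm
    · have h0 : ∀ a, (z : α ⊕ β → ℝ) (.inl a) = 0 := fun b => hzs _ (by simp)
      refine ⟨.inr ⟨fun a => (z : α ⊕ β → ℝ) (.inr a), mem_realization_iff.mpr
        ⟨⟨fun a => h.1 _, ?_⟩, t, ht, fun a ha => hzs _ (by simpa using ha)⟩⟩, ?_⟩
      · simpa [h0] using h.2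
      · refine Subtype.ext (funext ?_)
        rintro (a | b)
        · exact (h0 a).symm
        · rfl
  exact ⟨(Continuous.homeoOfEquivCompactToT2 (f := Equiv.ofBijective f ⟨hinj, hsurj⟩) hf).symm⟩

/-- The realization of the one-vertex complex is a point. -/
theorem nonempty_realization_top_unit_homeomorph :
    Nonempty (realization (⊤ : PreAbstractSimplicialComplex Unit) ≃ₜ Unit) := by
  have h1 : ∀ x : realization (⊤ : PreAbstractSimplicialComplex Unit),
      (x : Unit → ℝ) = fun _ => 1 := fun x =>
    funext fun _ => by simpa using (mem_realization_iff.mp x.2).1.2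
  have : Unique (realization (⊤ : PreAbstractSimplicialComplex Unit)) :=
    { default := ⟨fun _ => 1, mem_realization_iff.mpr
        ⟨⟨fun _ => zero_le_one, by simp⟩, {()}, Finset.singleton_nonempty _, by simp⟩⟩
      uniq := fun x => Subtype.ext (h1 x) }
  exact ⟨Homeomorph.homeomorphOfUnique _ _⟩

end Realization

/-! ### The cone with filled base -/

section ConeFill

variable {α : Type*}

/-- The union of the cone on `K`, with apex `none`, and the full simplex on the vertices of `K`. -/
def coneFill (K : PreAbstractSimplicialComplex α) : PreAbstractSimplicialComplex (Option α) where
  faces := {s | s.Nonempty ∧ (∀ a, some a ∈ s → a ∈ vertices K) ∧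
    (none ∈ s → s.eraseNone.Nonempty → s.eraseNone ∈ K.faces)}
  isRelLowerSet_faces := by
    rintro s ⟨hs, hv, hf⟩
    refine ⟨hs, fun t hts ht => ⟨ht, fun a ha => hv a (hts ha), fun hn hne => ?_⟩⟩
    have hsub : t.eraseNone ⊆ s.eraseNone := fun a ha =>
      Finset.mem_eraseNone.mpr (hts (Finset.mem_eraseNone.mp ha))
    exact (K.isRelLowerSet_faces (hf (hts hn) (hne.mono hsub))).2 hsub hne

/-- The point at height `t` on the segment from `x` to the apex of the cone. -/
def conePoint (x : α → ℝ) (t : ℝ) : Option α → ℝ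
  | none => t
  | some a => (1 - t) * x a

theorem mem_vertices_of_mem_face {K : PreAbstractSimplicialComplex α} {s : Finset α}
    (hs : s ∈ K.faces) {a : α} (ha : a ∈ s) : a ∈ vertices K :=
  (K.isRelLowerSet_faces hs).2 (Finset.singleton_subset_iff.mpr ha) (Finset.singleton_nonempty a)

theorem conePoint_mem_realization [Finite α] {K : PreAbstractSimplicialComplex α} {x : α → ℝ}
    (hx : x ∈ realization K) {t : ℝ} (h0 : 0 ≤ t) (h1 : t ≤ 1) :
    conePoint x t ∈ realization (coneFill K) := by
  have := Fintype.ofFinite α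
  obtain ⟨h, s, hs, hxs⟩ := mem_realization_iff.mp hx
  refine mem_realization_iff.mpr ⟨⟨?_, ?_⟩, Finset.insertNone s,
    ⟨Finset.insertNone_nonempty, fun a ha => ?_, fun _ _ => ?_⟩, ?_⟩
  · rintro (_ | a)
    · exact h0
    · exact mul_nonneg (by linarith) (h.1 a)
  · simp [Fintype.sum_option, conePoint, ← Finset.mul_sum, h.2]
  · exact mem_vertices_of_mem_face hs (Finset.some_mem_insertNone.mp ha)
  · rwa [Finset.eraseNone_insertNone]
  · rintro (_ | a) ha
    · exact absurd Finset.none_mem_insertNone ha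
    · simp [conePoint, hxs a fun h => ha (Finset.some_mem_insertNone.mpr h)]

/-- The points of height zero share a common face, namely the full simplex on the vertices of `K`,
so the segment between any two of them stays in the realization. -/
theorem exists_face_of_apply_none_eq_zero [Finite α] (K : PreAbstractSimplicialComplex α)
    (hK : (vertices K).Nonempty) :
    ∃ S ∈ (coneFill K).faces, ∀ z ∈ realization (coneFill K), z none = 0 →
      ∀ o, o ∉ S → z o = 0 := by
  classical
  have := Fintype.ofFinite α
  refine ⟨(Finset.univ.filter (· ∈ vertices K)).map Function.Embedding.some,
    ⟨?_, fun a ha => by simpa using ha, fun hn => by simp at hn⟩, ?_⟩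
  · obtain ⟨v, hv⟩ := hK
    exact ⟨some v, by simpa using hv⟩
  · rintro z ⟨_, s, hs, hzs, _⟩ hz (_ | a) ha
    · exact hz
    · exact hzs _ fun h => ha (by simpa using hs.2.1 a h)

/-- Every point of the realization either has height zero or lies on a segment from a point
of `|K|` to the apex. -/
theorem exists_conePoint_eq [Finite α] {K : PreAbstractSimplicialComplex α}
    (hK : (realization K).Nonempty) {z : Option α → ℝ} (hz : z ∈ realization (coneFill K))
    (hz0 : z none ≠ 0) : ∃ x ∈ realization K, conePoint x (z none) = z := by
  have := Fintype.ofFinite α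
  obtain ⟨⟨h0, h1⟩, s, hs, hzs⟩ := mem_realization_iff.mp hz
  rw [Fintype.sum_option] at h1
  have hn : none ∈ s := by
    by_contra h
    exact hz0 (hzs _ h)
  rcases eq_or_ne (z none) 1 with ht | ht
  · -- At the apex the point `x` is arbitrary.
    obtain ⟨x, hx⟩ := hK
    refine ⟨x, hx, funext ?_⟩
    have hsum : ∑ a, z (some a) = 0 := by linarith
    have hall := (Finset.sum_eq_zero_iff_of_nonneg fun a _ => h0 (some a)).mp hsum
    rintro (_ | a)
    · rfl
    · simp [conePoint, ht, hall a (Finset.mem_univ a)]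
  · have hpos : 0 < 1 - z none := by
      have : 0 ≤ ∑ a, z (some a) := Finset.sum_nonneg fun a _ => h0 (some a)
      exact lt_of_le_of_ne (by linarith) fun h => ht (by linarith)
    have hsum : ∑ a, z (some a) = 1 - z none := by linarith
    have hne : s.eraseNone.Nonempty := by
      by_contra h
      rw [Finset.not_nonempty_iff_eq_empty] at h
      have hall : ∀ a, z (some a) = 0 := fun a => hzs _ fun ha => by
        have := Finset.mem_eraseNone.mpr ha
        simp [h] at this
      simp [hall] at hsum
      linarith
    refine ⟨fun a => z (some a) / (1 - z none), mem_realization_iff.mpr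
      ⟨⟨fun a => div_nonneg (h0 _) hpos.le, ?_⟩, _, hs.2.2 hn hne, fun a ha => ?_⟩, funext ?_⟩
    · rw [← Finset.sum_div, hsum, div_self hpos.ne']
    · simp [hzs (some a) fun h => ha (Finset.mem_eraseNone.mpr h)]
    · rintro (_ | a)
      · rfl
      · exact mul_div_cancel₀ _ hpos.ne'

/-- Filling the base of the cone on `K` by a simplex gives the suspension of `|K|`. -/
theorem nonempty_coneFill_homotopyEquiv_suspension [Finite α] (K : PreAbstractSimplicialComplex α)
    (hK : (vertices K).Nonempty) :
    Nonempty (realization (coneFill K) ≃ₕ Suspension (realization K)) := by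
  classical
  have := Fintype.ofFinite α
  obtain ⟨v, hv⟩ := hK
  have hKne : (realization K).Nonempty := ⟨Pi.single v 1, mem_realization_iff.mpr
    ⟨single_mem_stdSimplex ℝ v, {v}, hv, fun w hw => Pi.single_eq_of_ne (by simpa using hw) _⟩⟩
  have : Nonempty (realization K) := hKne.to_subtype
  obtain ⟨x₀, hx₀⟩ := hKne
  obtain ⟨S, hS, hS0⟩ := exists_face_of_apply_none_eq_zero K ⟨v, hv⟩
  -- The points of height zero: the base, which straight lines contract to the point `b`.
  let L := realization (coneFill K)
  let D := {z : L // (z : Option α → ℝ) none = 0}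
  have hDclosed : IsClosed {z : L | (z : Option α → ℝ) none = 0} :=
    isClosed_eq ((continuous_apply none).comp continuous_subtype_val) continuous_const
  have : CompactSpace D := isCompact_iff_compactSpace.mp hDclosed.isCompact
  let c : C(realization K × unitInterval, L) :=
    ⟨fun p => ⟨conePoint p.1 p.2, conePoint_mem_realization p.1.2 p.2.2.1 p.2.2.2⟩,
      Continuous.subtype_mk (continuous_pi (by
        rintro (_ | a)
        · exact continuous_subtype_val.comp continuous_snd
        · have : Continuous fun p : realization K × unitInterval => (p.1 : α → ℝ) a :=
            (continuous_apply a).comp (continuous_subtype_val.comp continuous_fst)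
          exact (continuous_const.sub (continuous_subtype_val.comp continuous_snd)).mul this)) _⟩
  have hcs : ∀ x (t : unitInterval) a,
      (c (x, t) : Option α → ℝ) (some a) = (1 - (t : ℝ)) * (x : α → ℝ) a := fun _ _ _ => rfl
  let i : C(D, L) := ⟨Subtype.val, continuous_subtype_val⟩
  let j : C(realization K, D) := ⟨fun x => ⟨c (x, 0), rfl⟩, by fun_prop⟩
  let b : D := j ⟨x₀, hx₀⟩
  have hmem : ∀ p : unitInterval × D,
      (1 - (p.1 : ℝ)) • ((p.2 : L) : Option α → ℝ) + (p.1 : ℝ) • ((b : L) : Option α → ℝ) ∈ L :=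
    fun p => combo_mem_realization p.2.1.2 b.1.2 hS (hS0 _ p.2.1.2 p.2.2) (hS0 _ b.1.2 b.2)
      p.1.2.1 p.1.2.2
  have hmem0 : ∀ p : unitInterval × D, ((1 - (p.1 : ℝ)) • ((p.2 : L) : Option α → ℝ)
      + (p.1 : ℝ) • ((b : L) : Option α → ℝ)) none = 0 := fun p => by
    have h1 : ((p.2 : L) : Option α → ℝ) none = 0 := p.2.2
    have h2 : ((b : L) : Option α → ℝ) none = 0 := b.2
    simp [h1, h2]
  have hval : Continuous fun d : D => ((d : L) : Option α → ℝ) :=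
    continuous_subtype_val.comp continuous_subtype_val
  have hcomb : Continuous fun p : unitInterval × D =>
      (1 - (p.1 : ℝ)) • ((p.2 : L) : Option α → ℝ) + (p.1 : ℝ) • ((b : L) : Option α → ℝ) := by
    have hfst : Continuous fun p : unitInterval × D => (p.1 : ℝ) :=
      continuous_subtype_val.comp continuous_fst
    exact ((continuous_const.sub hfst).smul (hval.comp continuous_snd)).add
      (hfst.smul continuous_const)
  let h : (ContinuousMap.id D).Homotopy (ContinuousMap.const D b) :=
    ⟨⟨fun p => ⟨⟨_, hmem p⟩, hmem0 p⟩,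
      Continuous.subtype_mk (Continuous.subtype_mk hcomb _) _⟩,
      fun d => by ext o; simp, fun d => by ext o; simp⟩
  have hcont : Continuous (Sum.elim c i) := c.continuous.sumElim i.continuous
  refine nonempty_homotopyEquiv_suspension c i j h
    (IsQuotientMap.of_surjective_continuous ?_ hcont) (fun x => rfl) ?_ ?_ ?_
    Subtype.val_injective
  · intro z
    by_cases hz : (z : Option α → ℝ) none = 0
    · exact ⟨.inr ⟨z, hz⟩, rfl⟩
    · obtain ⟨x, hx, hxz⟩ := exists_conePoint_eq ⟨x₀, hx₀⟩ z.2 hz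
      have hz0 := (mem_realization_iff.mp z.2).1
      refine ⟨.inl (⟨x, hx⟩, ⟨(z : Option α → ℝ) none, hz0.1 none, ?_⟩), Subtype.ext hxz⟩
      rw [← hz0.2]
      exact Finset.single_le_sum (fun o _ => hz0.1 o) (Finset.mem_univ none)
  · intro x y
    refine Subtype.ext (funext ?_)
    rintro (_ | a)
    · rfl
    · simp [hcs]
  · rintro ⟨x, t⟩ ⟨y, s⟩ hxy
    have hv : ∀ o, (c (x, t) : Option α → ℝ) o = (c (y, s) : Option α → ℝ) o := fun o =>
      congrFun (congrArg Subtype.val hxy) o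
    obtain rfl : t = s := Subtype.ext (hv none)
    by_cases ht : t = 1
    · exact Or.inr (Or.inr ⟨ht, ht⟩)
    · refine Or.inl (Prod.ext (Subtype.ext (funext fun a => ?_)) rfl)
      have := hv (some a)
      rw [hcs, hcs] at this
      exact mul_left_cancel₀ (fun h => ht (Subtype.ext (sub_eq_zero.mp h).symm)) this
  · intro x t d hd
    have ht : t = 0 := Subtype.ext ((congrFun (congrArg Subtype.val hd) none).trans d.2)
    subst ht
    exact ⟨rfl, Subtype.ext hd.symm⟩

end ConeFill

/-! ### Faces of the three complexes -/

section Mycielskian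

variable {V : Type*}

theorem collapse_mk_eq_iff {S : Set (Fin 3)} {g h : V} {i k : Fin 3} :
    Quotient.mk (collapse V S) (g, i) = Quotient.mk (collapse V S) (h, k) ↔
      i = k ∧ (g = h ∨ i ∈ S) := by
  rw [Quotient.eq]
  change (_ = _ ∨ _) ↔ _
  simp only [Prod.mk.injEq]
  tauto

/-- The first kind of face lies in the out-neighborhood of a vertex of level `0`, the second in that
of a vertex of level `1`; the class of level `2` has no outgoing edges. -/
theorem mem_faces_M₁_iff {G : Digraph V} {s : Finset (Quotient (collapse V {2}))} :
    s ∈ (outNbhdComplex (M₁ G)).faces ↔ s.Nonempty ∧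
      ((∃ v, ∀ w ∈ s, ∃ h, G.Adj v h ∧
        (w = Quotient.mk _ (h, 0) ∨ w = Quotient.mk _ (h, 1))) ∨
      ∃ v, ∀ w ∈ s, ∃ h, G.Adj v h ∧ w = Quotient.mk _ (h, 2)) := by
  refine and_congr_right fun hs => ⟨?_, ?_⟩
  · rintro ⟨a, ha⟩
    induction a using Quotient.inductionOn with | _ p
    obtain ⟨g, i⟩ := p
    fin_cases i
    · refine Or.inl ⟨g, fun w hw => ?_⟩
      obtain ⟨⟨x, i⟩, ⟨h, k⟩, ⟨hG, hI⟩, hx, rfl⟩ := ha w hw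
      obtain ⟨rfl, rfl | hi⟩ := collapse_mk_eq_iff.mp hx
      · exact ⟨h, hG, by simp [I₁] at hI; rcases hI with rfl | rfl <;> simp⟩
      · simp at hi
    · refine Or.inr ⟨g, fun w hw => ?_⟩
      obtain ⟨⟨x, i⟩, ⟨h, k⟩, ⟨hG, hI⟩, hx, rfl⟩ := ha w hw
      obtain ⟨rfl, rfl | hi⟩ := collapse_mk_eq_iff.mp hx
      · exact ⟨h, hG, by simp [I₁] at hI; simp [hI]⟩
      · simp at hi
    · obtain ⟨w, hw⟩ := hs
      obtain ⟨⟨x, i⟩, ⟨h, k⟩, ⟨hG, hI⟩, hx, rfl⟩ := ha w hw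
      obtain ⟨rfl, -⟩ := collapse_mk_eq_iff.mp hx
      simp [I₁] at hI
  · rintro (⟨v, hv⟩ | ⟨v, hv⟩)
    · refine ⟨Quotient.mk _ (v, 0), fun w hw => ?_⟩
      obtain ⟨h, hG, rfl | rfl⟩ := hv w hw
      · exact ⟨(v, 0), (h, 0), ⟨hG, by simp [I₁]⟩, rfl, rfl⟩
      · exact ⟨(v, 0), (h, 1), ⟨hG, by simp [I₁]⟩, rfl, rfl⟩
    · refine ⟨Quotient.mk _ (v, 1), fun w hw => ?_⟩
      obtain ⟨h, hG, rfl⟩ := hv w hw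
      exact ⟨(v, 1), (h, 2), ⟨hG, by simp [I₁]⟩, rfl, rfl⟩

/-- A vertex at level `0` or `1` has the same out-neighborhood as in `G`, put at level `0`. The class
of level `2` collects the edges leaving every `(v, 2)`, so it sees all of the vertices of positive
in-degree at level `1`. -/
theorem mem_faces_M₂_iff {G : Digraph V} {s : Finset (Quotient (collapse V {2}))} :
    s ∈ (outNbhdComplex (M₂ G)).faces ↔ s.Nonempty ∧
      ((∃ v, ∀ w ∈ s, ∃ h, G.Adj v h ∧ w = Quotient.mk _ (h, 0)) ∨
      ∀ w ∈ s, ∃ v h, G.Adj v h ∧ w = Quotient.mk _ (h, 1)) := by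
  refine and_congr_right fun hs => ⟨?_, ?_⟩
  · rintro ⟨a, ha⟩
    induction a using Quotient.inductionOn with | _ p
    obtain ⟨g, i⟩ := p
    fin_cases i
    · refine Or.inl ⟨g, fun w hw => ?_⟩
      obtain ⟨⟨x, i⟩, ⟨h, k⟩, ⟨hG, hI⟩, hx, rfl⟩ := ha w hw
      obtain ⟨rfl, rfl | hi⟩ := collapse_mk_eq_iff.mp hx
      · exact ⟨h, hG, by simp [I₂] at hI; simp [hI]⟩
      · simp at hi
    · refine Or.inl ⟨g, fun w hw => ?_⟩
      obtain ⟨⟨x, i⟩, ⟨h, k⟩, ⟨hG, hI⟩, hx, rfl⟩ := ha w hw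
      obtain ⟨rfl, rfl | hi⟩ := collapse_mk_eq_iff.mp hx
      · exact ⟨h, hG, by simp [I₂] at hI; simp [hI]⟩
      · simp at hi
    · refine Or.inr fun w hw => ?_
      obtain ⟨⟨x, i⟩, ⟨h, k⟩, ⟨hG, hI⟩, hx, rfl⟩ := ha w hw
      obtain ⟨rfl, -⟩ := collapse_mk_eq_iff.mp hx
      exact ⟨x, h, hG, by simp [I₂] at hI; simp [hI]⟩
  · rintro (⟨v, hv⟩ | hv)
    · refine ⟨Quotient.mk _ (v, 0), fun w hw => ?_⟩
      obtain ⟨h, hG, rfl⟩ := hv w hw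
      exact ⟨(v, 0), (h, 0), ⟨hG, by simp [I₂]⟩, rfl, rfl⟩
    · obtain ⟨w₀, hw₀⟩ := hs
      obtain ⟨v₀, -⟩ := hv w₀ hw₀
      refine ⟨Quotient.mk _ (v₀, 2), fun w hw => ?_⟩
      obtain ⟨v, h, hG, rfl⟩ := hv w hw
      exact ⟨(v, 2), (h, 1), ⟨hG, by simp [I₂]⟩, by simp [collapse_mk_eq_iff], rfl⟩

/-- The class of level `0` sees all of the vertices of positive in-degree at level `1`. A vertex at
level `1` sees its out-neighborhood at level `1` and, if that is nonempty, the class of level `2`,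
which itself has no outgoing edges. -/
theorem mem_faces_M₃_iff {G : Digraph V} {s : Finset (Quotient (collapse V {0, 2}))} :
    s ∈ (outNbhdComplex (M₃ G)).faces ↔ s.Nonempty ∧
      ((∀ w ∈ s, ∃ v h, G.Adj v h ∧ w = Quotient.mk _ (h, 1)) ∨
      ∃ v, ∀ w ∈ s, ∃ h, G.Adj v h ∧
        (w = Quotient.mk _ (h, 1) ∨ w = Quotient.mk _ (h, 2))) := by
  refine and_congr_right fun hs => ⟨?_, ?_⟩
  · rintro ⟨a, ha⟩
    induction a using Quotient.inductionOn with | _ p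
    obtain ⟨g, i⟩ := p
    fin_cases i
    · refine Or.inl fun w hw => ?_
      obtain ⟨⟨x, i⟩, ⟨h, k⟩, ⟨hG, hI⟩, hx, rfl⟩ := ha w hw
      obtain ⟨rfl, -⟩ := collapse_mk_eq_iff.mp hx
      exact ⟨x, h, hG, by simp [I₃] at hI; simp [hI]⟩
    · refine Or.inr ⟨g, fun w hw => ?_⟩
      obtain ⟨⟨x, i⟩, ⟨h, k⟩, ⟨hG, hI⟩, hx, rfl⟩ := ha w hw
      obtain ⟨rfl, rfl | hi⟩ := collapse_mk_eq_iff.mp hx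
      · exact ⟨h, hG, by simp [I₃] at hI; rcases hI with rfl | rfl <;> simp⟩
      · simp at hi
    · obtain ⟨w, hw⟩ := hs
      obtain ⟨⟨x, i⟩, ⟨h, k⟩, ⟨hG, hI⟩, hx, rfl⟩ := ha w hw
      obtain ⟨rfl, -⟩ := collapse_mk_eq_iff.mp hx
      simp [I₃] at hI
  · rintro (hv | ⟨v, hv⟩)
    · obtain ⟨w₀, hw₀⟩ := hs
      obtain ⟨v₀, -⟩ := hv w₀ hw₀
      refine ⟨Quotient.mk _ (v₀, 0), fun w hw => ?_⟩
      obtain ⟨v, h, hG, rfl⟩ := hv w hw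
      exact ⟨(v, 0), (h, 1), ⟨hG, by simp [I₃]⟩, by simp [collapse_mk_eq_iff], rfl⟩
    · refine ⟨Quotient.mk _ (v, 1), fun w hw => ?_⟩
      obtain ⟨h, hG, rfl | rfl⟩ := hv w hw
      · exact ⟨(v, 1), (h, 1), ⟨hG, by simp [I₃]⟩, rfl, rfl⟩
      · exact ⟨(v, 1), (h, 2), ⟨hG, by simp [I₃]⟩, rfl, rfl⟩

theorem mem_faces_disjointUnion_top_iff {β : Type*} {G : Digraph V} {s : Finset (V ⊕ β)} :
    s ∈ (disjointUnion (outNbhdComplex G) (⊤ : PreAbstractSimplicialComplex β)).faces ↔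
      s.Nonempty ∧ ((∃ v, ∀ w ∈ s, ∃ h, G.Adj v h ∧ w = .inl h) ∨ ∀ w ∈ s, ∃ b, w = .inr b) := by
  constructor
  · rintro (⟨t, ⟨ht, v, hv⟩, rfl⟩ | ⟨t, ht, rfl⟩)
    · refine ⟨ht.map, Or.inl ⟨v, fun w hw => ?_⟩⟩
      obtain ⟨h, hh, rfl⟩ := Finset.mem_map.mp hw
      exact ⟨h, hv h hh, rfl⟩
    · refine ⟨Finset.Nonempty.map ht, Or.inr fun w hw => ?_⟩
      obtain ⟨b, -, rfl⟩ := Finset.mem_map.mp hw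
      exact ⟨b, rfl⟩
  · rintro ⟨hs, ⟨v, hv⟩ | hv⟩
    · have e : s = s.toLeft.map Function.Embedding.inl := by
        ext w
        simp only [Finset.mem_map, Finset.mem_toLeft, Function.Embedding.inl_apply]
        refine ⟨fun hw => ?_, by rintro ⟨h, hh, rfl⟩; exact hh⟩
        obtain ⟨h, -, rfl⟩ := hv w hw
        exact ⟨h, hw, rfl⟩
      refine Or.inl ⟨s.toLeft, ⟨?_, v, fun h hh => ?_⟩, e⟩
      · rw [e] at hs
        exact Finset.map_nonempty.mp hs
      · obtain ⟨h', hG, hh'⟩ := hv _ (Finset.mem_toLeft.mp hh)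
        rwa [Sum.inl.inj hh']
    · have e : s = s.toRight.map Function.Embedding.inr := by
        ext w
        simp only [Finset.mem_map, Finset.mem_toRight, Function.Embedding.inr_apply]
        refine ⟨fun hw => ?_, by rintro ⟨h, hh, rfl⟩; exact hh⟩
        obtain ⟨h, rfl⟩ := hv w hw
        exact ⟨h, hw, rfl⟩
      refine Or.inr ⟨s.toRight, ?_, e⟩
      rw [e] at hs
      exact Finset.map_nonempty.mp hs

/-! ### Simplicial isomorphisms -/

/-- An injective map of vertices that preserves and reflects faces and covers all vertices is an
isomorphism of complexes. -/
noncomputable def SimplicialIso.ofEmbedding {α β : Type*} {K : PreAbstractSimplicialComplex α}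
    {L : PreAbstractSimplicialComplex β} (f : β ↪ α)
    (hf : ∀ s : Finset β, s.map f ∈ K.faces ↔ s ∈ L.faces) (hr : vertices K ⊆ Set.range f) :
    SimplicialIso K L :=
  have hv : ∀ b, f b ∈ vertices K ↔ b ∈ vertices L := fun b => by
    have := hf {b}
    rwa [Finset.map_singleton] at this
  let F : vertices L → vertices K := fun b => ⟨f b, (hv b).mpr b.2⟩
  have hF : Function.Bijective F := by
    refine ⟨fun b b' h => Subtype.ext (f.injective (congrArg Subtype.val h)), fun a => ?_⟩
    obtain ⟨b, hb⟩ := hr a.2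
    exact ⟨⟨b, (hv b).mp (hb ▸ a.2)⟩, Subtype.ext hb⟩
  { toEquiv := (Equiv.ofBijective F hF).symm
    mem_faces_iff := fun s => by
      rw [← hf, Finset.map_map, Finset.map_map]
      have : (Equiv.ofBijective F hF).symm.toEmbedding.trans
          ((Function.Embedding.subtype _).trans f) = Function.Embedding.subtype _ := by
        ext a
        exact congrArg Subtype.val ((Equiv.ofBijective F hF).apply_symm_apply a)
      rw [this] }

theorem nonempty_simplicialIso_M₂ [Finite V] (G : Digraph V) {m : ℕ}
    (hm : (vertices (outNbhdComplex G)).ncard = m + 1) :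
    Nonempty (SimplicialIso (outNbhdComplex (M₂ G))
      (disjointUnion (outNbhdComplex G) (simplex m))) := by
  let e : vertices (outNbhdComplex G) ≃ Fin (m + 1) := Finite.equivFinOfCardEq hm
  let f : V ⊕ Fin (m + 1) ↪ Quotient (collapse V {2}) :=
    ⟨Sum.elim (fun v => Quotient.mk _ (v, 0)) (fun k => Quotient.mk _ ((e.symm k : V), 1)), by
      rintro (a | a) (b | b) hab
      · simpa [collapse_mk_eq_iff] using hab
      · simp [collapse_mk_eq_iff] at hab
      · simp [collapse_mk_eq_iff] at hab
      · simpa [collapse_mk_eq_iff, Subtype.ext_iff.symm] using hab⟩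
  have fl : ∀ v, f (.inl v) = Quotient.mk _ (v, 0) := fun _ => rfl
  have fr : ∀ k, f (.inr k) = Quotient.mk _ ((e.symm k : V), 1) := fun _ => rfl
  have f0 : ∀ x h, f x = Quotient.mk _ (h, 0) ↔ x = .inl h := by
    rintro (a | a) h <;> simp [fl, fr, collapse_mk_eq_iff]
  have f1 : ∀ x, (∃ v h, G.Adj v h ∧ f x = Quotient.mk _ (h, 1)) ↔ ∃ k, x = .inr k := by
    rintro (a | k)
    · simp [fl, collapse_mk_eq_iff]
    · obtain ⟨v, hv⟩ := (mem_vertices_outNbhdComplex G _).mp (e.symm k).2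
      exact iff_of_true ⟨v, _, hv, fr k⟩ ⟨k, rfl⟩
  refine ⟨SimplicialIso.ofEmbedding f (fun s => ?_) fun w hw => ?_⟩
  · rw [mem_faces_M₂_iff]
    refine Iff.trans ?_ mem_faces_disjointUnion_top_iff.symm
    simp only [Finset.map_nonempty, Finset.forall_mem_map, f0, f1]
  · obtain ⟨-, ⟨v, hv⟩ | hv⟩ := mem_faces_M₂_iff.mp hw
    · obtain ⟨h, -, rfl⟩ := hv w (Finset.mem_singleton_self w)
      exact ⟨.inl h, rfl⟩
    · obtain ⟨v, h, hG, rfl⟩ := hv w (Finset.mem_singleton_self w)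
      refine ⟨.inr (e ⟨h, (mem_vertices_outNbhdComplex G h).mpr ⟨v, hG⟩⟩), ?_⟩
      rw [fr, e.symm_apply_apply]

/-! ### Homotopy equivalences -/

theorem nonempty_homotopyEquiv_M₁ [Finite V] (G : Digraph V)
    (hG : (vertices (outNbhdComplex G)).Nonempty) :
    Nonempty (realization (outNbhdComplex (M₁ G)) ≃ₕ realization (outNbhdComplex G) ⊕ Unit) := by
  classical
  obtain ⟨h₀, h₀mem⟩ := hG
  obtain ⟨v₀, hv₀⟩ := (mem_vertices_outNbhdComplex G h₀).mp h₀mem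
  let φ : Quotient (collapse V {2}) → V ⊕ Unit :=
    Quotient.lift (fun p => if p.2 = 2 then .inr () else .inl p.1) (by
      rintro ⟨g, i⟩ ⟨h, k⟩ (hp | ⟨rfl, hi⟩)
      · rw [hp]
      · simp_all)
  have φ0 : ∀ h, φ (Quotient.mk _ (h, 0)) = .inl h := fun _ => rfl
  have φ1 : ∀ h, φ (Quotient.mk _ (h, 1)) = .inl h := fun _ => rfl
  have φ2 : ∀ h, φ (Quotient.mk _ (h, 2)) = .inr () := fun _ => rfl
  let ψ : V ⊕ Unit → Quotient (collapse V {2}) :=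
    Sum.elim (fun v => Quotient.mk _ (v, 0)) (fun _ => Quotient.mk _ (h₀, 2))
  have ψl : ∀ h, ψ (.inl h) = Quotient.mk _ (h, 0) := fun _ => rfl
  have ψr : ∀ u, ψ (.inr u) = Quotient.mk _ (h₀, 2) := fun _ => rfl
  have h2 : ∀ h : V, Quotient.mk (collapse V {2}) (h, 2) = Quotient.mk _ (h₀, 2) := fun h => by
    simp [collapse_mk_eq_iff]
  obtain ⟨E⟩ : Nonempty (realization (outNbhdComplex (M₁ G)) ≃ₕ realization
      (disjointUnion (outNbhdComplex G) (⊤ : PreAbstractSimplicialComplex Unit))) := by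
    refine nonempty_homotopyEquiv_of_contiguous φ ψ ?_ ?_ ?_ ?_
    · intro s hs
      rw [mem_faces_M₁_iff] at hs
      rw [mem_faces_disjointUnion_top_iff]
      simp only [Finset.image_nonempty, Finset.forall_mem_image]
      obtain ⟨hs, ⟨v, hv⟩ | ⟨v, hv⟩⟩ := hs
      · refine ⟨hs, Or.inl ⟨v, fun w hw => ?_⟩⟩
        obtain ⟨h, hvh, rfl | rfl⟩ := hv w hw
        exacts [⟨h, hvh, φ0 h⟩, ⟨h, hvh, φ1 h⟩]
      · refine ⟨hs, Or.inr fun w hw => ?_⟩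
        obtain ⟨h, hvh, rfl⟩ := hv w hw
        exact ⟨(), φ2 h⟩
    · intro s hs
      rw [mem_faces_disjointUnion_top_iff] at hs
      rw [mem_faces_M₁_iff]
      simp only [Finset.image_nonempty, Finset.forall_mem_image]
      obtain ⟨hs, ⟨v, hv⟩ | hv⟩ := hs
      · refine ⟨hs, Or.inl ⟨v, fun w hw => ?_⟩⟩
        obtain ⟨h, hvh, rfl⟩ := hv w hw
        exact ⟨h, hvh, Or.inl (ψl h)⟩
      · refine ⟨hs, Or.inr ⟨v₀, fun w hw => ?_⟩⟩
        obtain ⟨u, rfl⟩ := hv w hw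
        exact ⟨h₀, hv₀, ψr u⟩
    · intro s hs
      rw [mem_faces_M₁_iff] at hs ⊢
      simp only [Finset.forall_mem_union, Finset.forall_mem_image, Function.comp_apply]
      obtain ⟨hs, ⟨v, hv⟩ | ⟨v, hv⟩⟩ := hs
      · refine ⟨hs.mono Finset.subset_union_left, Or.inl ⟨v, hv, fun w hw => ?_⟩⟩
        obtain ⟨h, hvh, rfl | rfl⟩ := hv w hw
        exacts [⟨h, hvh, Or.inl rfl⟩, ⟨h, hvh, Or.inl rfl⟩]
      · refine ⟨hs.mono Finset.subset_union_left, Or.inr ⟨v, hv, fun w hw => ?_⟩⟩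
        obtain ⟨h, hvh, rfl⟩ := hv w hw
        exact ⟨h, hvh, (h2 h).symm⟩
    · intro s hs
      have : φ ∘ ψ = id := by
        funext x
        rcases x with a | u <;> rfl
      rwa [this, Finset.image_id, Finset.union_self]
  obtain ⟨F⟩ := nonempty_realization_disjointUnion_homeomorph (outNbhdComplex G)
    (⊤ : PreAbstractSimplicialComplex Unit)
  obtain ⟨P⟩ := nonempty_realization_top_unit_homeomorph
  exact ⟨E.trans (F.trans ((Homeomorph.refl _).sumCongr P)).toHomotopyEquiv⟩

theorem nonempty_homotopyEquiv_M₁_M₂ [Finite V] (G : Digraph V)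
    (hG : (vertices (outNbhdComplex G)).Nonempty) :
    Nonempty (realization (outNbhdComplex (M₁ G)) ≃ₕ realization (outNbhdComplex (M₂ G))) := by
  classical
  obtain ⟨h₀, h₀mem⟩ := hG
  obtain ⟨v₀, hv₀⟩ := (mem_vertices_outNbhdComplex G h₀).mp h₀mem
  -- `φ` flattens levels `0` and `1`; it sends the isolated vertex to the extra simplex, which `ψ`
  -- collapses back.
  let φ : Quotient (collapse V {2}) → Quotient (collapse V {2}) :=
    Quotient.lift (fun p => if p.2 = 2 then Quotient.mk _ (h₀, 1) else Quotient.mk _ (p.1, 0)) (by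
      rintro ⟨g, i⟩ ⟨h, k⟩ (hp | ⟨rfl, hi⟩)
      · rw [hp]
      · simp_all)
  have φ0 : ∀ h, φ (Quotient.mk _ (h, 0)) = Quotient.mk _ (h, 0) := fun _ => rfl
  have φ1 : ∀ h, φ (Quotient.mk _ (h, 1)) = Quotient.mk _ (h, 0) := fun _ => rfl
  have φ2 : ∀ h, φ (Quotient.mk _ (h, 2)) = Quotient.mk _ (h₀, 1) := fun _ => rfl
  let ψ : Quotient (collapse V {2}) → Quotient (collapse V {2}) :=
    Quotient.lift (fun p => if p.2 = 0 then Quotient.mk _ (p.1, 0) else Quotient.mk _ (h₀, 2)) (by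
      rintro ⟨g, i⟩ ⟨h, k⟩ (hp | ⟨rfl, hi⟩)
      · rw [hp]
      · simp_all)
  have ψ0 : ∀ h, ψ (Quotient.mk _ (h, 0)) = Quotient.mk _ (h, 0) := fun _ => rfl
  have ψ1 : ∀ h, ψ (Quotient.mk _ (h, 1)) = Quotient.mk _ (h₀, 2) := fun _ => rfl
  have h2 : ∀ h : V, Quotient.mk (collapse V {2}) (h, 2) = Quotient.mk _ (h₀, 2) := fun h => by
    simp [collapse_mk_eq_iff]
  refine nonempty_homotopyEquiv_of_contiguous φ ψ ?_ ?_ ?_ ?_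
  · intro s hs
    rw [mem_faces_M₁_iff] at hs
    rw [mem_faces_M₂_iff]
    simp only [Finset.image_nonempty, Finset.forall_mem_image]
    obtain ⟨hs, ⟨v, hv⟩ | ⟨v, hv⟩⟩ := hs
    · refine ⟨hs, Or.inl ⟨v, fun w hw => ?_⟩⟩
      obtain ⟨h, hvh, rfl | rfl⟩ := hv w hw
      exacts [⟨h, hvh, φ0 h⟩, ⟨h, hvh, φ1 h⟩]
    · refine ⟨hs, Or.inr fun w hw => ?_⟩
      obtain ⟨h, hvh, rfl⟩ := hv w hw
      exact ⟨v₀, h₀, hv₀, φ2 h⟩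
  · intro s hs
    rw [mem_faces_M₂_iff] at hs
    rw [mem_faces_M₁_iff]
    simp only [Finset.image_nonempty, Finset.forall_mem_image]
    obtain ⟨hs, ⟨v, hv⟩ | hv⟩ := hs
    · refine ⟨hs, Or.inl ⟨v, fun w hw => ?_⟩⟩
      obtain ⟨h, hvh, rfl⟩ := hv w hw
      exact ⟨h, hvh, Or.inl (ψ0 h)⟩
    · refine ⟨hs, Or.inr ⟨v₀, fun w hw => ?_⟩⟩
      obtain ⟨v, h, hvh, rfl⟩ := hv w hw
      exact ⟨h₀, hv₀, ψ1 h⟩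
  · intro s hs
    rw [mem_faces_M₁_iff] at hs ⊢
    simp only [Finset.forall_mem_union, Finset.forall_mem_image, Function.comp_apply]
    obtain ⟨hs, ⟨v, hv⟩ | ⟨v, hv⟩⟩ := hs
    · refine ⟨hs.mono Finset.subset_union_left, Or.inl ⟨v, hv, fun w hw => ?_⟩⟩
      obtain ⟨h, hvh, rfl | rfl⟩ := hv w hw
      exacts [⟨h, hvh, Or.inl rfl⟩, ⟨h, hvh, Or.inl rfl⟩]
    · refine ⟨hs.mono Finset.subset_union_left, Or.inr ⟨v, hv, fun w hw => ?_⟩⟩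
      obtain ⟨h, hvh, rfl⟩ := hv w hw
      exact ⟨h, hvh, (h2 h).symm⟩
  · intro s hs
    rw [mem_faces_M₂_iff] at hs ⊢
    simp only [Finset.forall_mem_union, Finset.forall_mem_image, Function.comp_apply]
    obtain ⟨hs, ⟨v, hv⟩ | hv⟩ := hs
    · refine ⟨hs.mono Finset.subset_union_left, Or.inl ⟨v, hv, fun w hw => ?_⟩⟩
      obtain ⟨h, hvh, rfl⟩ := hv w hw
      exact ⟨h, hvh, rfl⟩
    · refine ⟨hs.mono Finset.subset_union_left, Or.inr ⟨hv, fun w hw => ?_⟩⟩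
      obtain ⟨v, h, hvh, rfl⟩ := hv w hw
      exact ⟨v₀, h₀, hv₀, rfl⟩

/-- Level `1` of the third Mycielskian carries the full simplex, and the class of level `2` is the
apex of a cone over the original complex; the class of level `0` is not a vertex. -/
theorem nonempty_homotopyEquiv_M₃_coneFill [Finite V] (G : Digraph V)
    (hG : (vertices (outNbhdComplex G)).Nonempty) :
    Nonempty (realization (outNbhdComplex (M₃ G)) ≃ₕ
      realization (coneFill (outNbhdComplex G))) := by
  classical
  obtain ⟨h₀, h₀mem⟩ := hG
  obtain ⟨v₀, hv₀⟩ := (mem_vertices_outNbhdComplex G h₀).mp h₀mem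
  let φ : Quotient (collapse V {0, 2}) → Option V :=
    Quotient.lift (fun p => if p.2 = 1 then some p.1 else none) (by
      rintro ⟨g, i⟩ ⟨h, k⟩ (hp | ⟨rfl, hi⟩)
      · rw [hp]
      · have hi' : i = 0 ∨ i = 2 := hi
        rcases hi' with rfl | rfl <;> rfl)
  let ψ : Option V → Quotient (collapse V {0, 2})
    | none => Quotient.mk _ (h₀, 2)
    | some v => Quotient.mk _ (v, 1)
  have h2 : ∀ h : V, Quotient.mk (collapse V {0, 2}) (h₀, 2) = Quotient.mk _ (h, 2) := fun h => by
    simp [collapse_mk_eq_iff]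
  refine nonempty_homotopyEquiv_of_contiguous φ ψ ?_ ?_ ?_ ?_
  · intro s hs
    obtain ⟨hs, hv | ⟨v, hv⟩⟩ := mem_faces_M₃_iff.mp hs
    · refine ⟨hs.image φ, fun a ha => ?_, fun hn => ?_⟩
      · obtain ⟨w, hw, hwa⟩ := Finset.mem_image.mp ha
        obtain ⟨v, h, hvh, rfl⟩ := hv w hw
        obtain rfl : h = a := Option.some.inj hwa
        exact (mem_vertices_outNbhdComplex G h).mpr ⟨v, hvh⟩
      · obtain ⟨w, hw, hwn⟩ := Finset.mem_image.mp hn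
        obtain ⟨v, h, hvh, rfl⟩ := hv w hw
        exact absurd hwn (Option.some_ne_none h)
    · have key : ∀ a, some a ∈ s.image φ → G.Adj v a := fun a ha => by
        obtain ⟨w, hw, hwa⟩ := Finset.mem_image.mp ha
        obtain ⟨h, hvh, rfl | rfl⟩ := hv w hw
        · obtain rfl : h = a := Option.some.inj hwa
          exact hvh
        · exact absurd hwa.symm (Option.some_ne_none a)
      exact ⟨hs.image φ, fun a ha => (mem_vertices_outNbhdComplex G a).mpr ⟨v, key a ha⟩,
        fun _ hne => ⟨hne, v, fun a ha => key a (Finset.mem_eraseNone.mp ha)⟩⟩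
  · rintro s ⟨hs, hv, hf⟩
    refine mem_faces_M₃_iff.mpr ⟨hs.image ψ, ?_⟩
    simp only [Finset.forall_mem_image]
    by_cases hn : none ∈ s
    · obtain ⟨v, h, hvh, hall⟩ : ∃ v h, G.Adj v h ∧ ∀ a, some a ∈ s → G.Adj v a := by
        by_cases hne : s.eraseNone.Nonempty
        · obtain ⟨-, v, hva⟩ := hf hn hne
          obtain ⟨h, hh⟩ := hne
          exact ⟨v, h, hva h hh, fun a ha => hva a (Finset.mem_eraseNone.mpr ha)⟩
        · exact ⟨v₀, h₀, hv₀, fun a ha => absurd ⟨a, Finset.mem_eraseNone.mpr ha⟩ hne⟩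
      refine Or.inr ⟨v, ?_⟩
      rintro (_ | a) ha
      · exact ⟨h, hvh, Or.inr (h2 h)⟩
      · exact ⟨a, hall a ha, Or.inl rfl⟩
    · refine Or.inl ?_
      rintro (_ | a) ha
      · exact absurd ha hn
      · obtain ⟨v, hva⟩ := (mem_vertices_outNbhdComplex G a).mp (hv a ha)
        exact ⟨v, a, hva, rfl⟩
  · intro s hs
    -- The composite fixes every vertex of the complex.
    have hfix : s.image (ψ ∘ φ) = s := by
      refine (Finset.image_congr fun w hw => ?_).trans Finset.image_id
      obtain ⟨-, hv | ⟨v, hv⟩⟩ := mem_faces_M₃_iff.mp hs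
      · obtain ⟨v, h, -, rfl⟩ := hv w hw
        rfl
      · obtain ⟨h, -, rfl | rfl⟩ := hv w hw
        · rfl
        · exact h2 h
    rwa [hfix, Finset.union_self]
  · intro s hs
    have : φ ∘ ψ = id := by
      funext x
      rcases x with _ | a <;> rfl
    rwa [this, Finset.image_id, Finset.union_self]

end Mycielskian
end DirectedMycielskian

theorem mainTheorem6 {V : Type*} [Finite V] (G : Digraph V) (n : ℕ)
    (hn : (DirectedMycielskian.vertices (DirectedMycielskian.outNbhdComplex G)).ncard = n)
    (hpos : 0 < n) :
    Nonempty
      (DirectedMycielskian.realization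
          (DirectedMycielskian.outNbhdComplex (DirectedMycielskian.M₁ G)) ≃ₕ
        DirectedMycielskian.realization (DirectedMycielskian.outNbhdComplex G) ⊕ Unit) ∧
    Nonempty
      (DirectedMycielskian.SimplicialIso
        (DirectedMycielskian.outNbhdComplex (DirectedMycielskian.M₂ G))
        (DirectedMycielskian.disjointUnion (DirectedMycielskian.outNbhdComplex G)
          (DirectedMycielskian.simplex (n - 1)))) ∧
    Nonempty
      (DirectedMycielskian.realization
          (DirectedMycielskian.outNbhdComplex (DirectedMycielskian.M₁ G)) ≃ₕ
        DirectedMycielskian.realization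
          (DirectedMycielskian.outNbhdComplex (DirectedMycielskian.M₂ G))) ∧
    Nonempty
      (DirectedMycielskian.realization
          (DirectedMycielskian.outNbhdComplex (DirectedMycielskian.M₃ G)) ≃ₕ
        DirectedMycielskian.Suspension
          (DirectedMycielskian.realization (DirectedMycielskian.outNbhdComplex G))) := by
  have hne : (DirectedMycielskian.vertices (DirectedMycielskian.outNbhdComplex G)).Nonempty :=
    Set.nonempty_of_ncard_ne_zero (by omega)
  refine ⟨DirectedMycielskian.nonempty_homotopyEquiv_M₁ G hne,
    DirectedMycielskian.nonempty_simplicialIso_M₂ G (by omega),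
    DirectedMycielskian.nonempty_homotopyEquiv_M₁_M₂ G hne, ?_⟩
  obtain ⟨E⟩ := DirectedMycielskian.nonempty_homotopyEquiv_M₃_coneFill G hne
  obtain ⟨F⟩ := DirectedMycielskian.nonempty_coneFill_homotopyEquiv_suspension _ hne
  exact ⟨E.trans F⟩
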